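/- Let $\widetilde B_\bullet$ be the group generated by two infinite families $\sigma_i$ and $a_i$ ($i\ge 1$), subject to the following relations, for all $i\ge 1$ and $j\ge i+2$: $$\sigma_i\sigma_j=\sigma_j\sigma_i,\qquad \sigma_i a_j=a_j\sigma_i,\qquad a_i a_{j-1}=a_j a_i,\qquad a_i\sigma_{j-1}=\sigma_j a_i,$$ $$\sigma_i\sigma_{i+1}\sigma_i=\sigma_{i+1}\sigma_i\sigma_{i+1},\qquad \sigma_{i+1}\sigma_i a_{i+1}=a_i\sigma_i,\qquad \sigma_i\sigma_{i+1}a_i=a_{i+1}\sigma_i.$$ Let $B_\infty$ be Artin's braid group, generated by $s_i$ ($i\ge 1$) with relations $s_is_j=s_js_i$ for $j\ge i+2$ and $s_is_{i+1}s_i=s_{i+1}s_is_{i+1}$, and let $F$ be Thompson's group, generated by $x_n$ ($n\ge 0$) with relations $x_k^{-1}x_nx_k=x_{n+1}$ for $k<n$. Then: 1. $s_i\mapsto\sigma_i$ ($i\ge 1$) induces an isomorphism from $B_\infty$ onto the subgroup of $\widetilde B_\bullet$ generated by all the $\sigma_i$. 2. $x_{i-1}\mapsto a_i^{-1}$ ($i\ge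 1$) induces an isomorphism from $F$ onto the subgroup of $\widetilde B_\bullet$ generated by all the $a_i$. 3. These two subgroups together generate $\widetilde B_\bullet$, and their intersection is $\{1\}$. -/

import Mathlib

/-!
All families of generators are indexed here by `ℕ`, so that `sigma i` and `a i` stand for
`σ_{i+1}` and `a_{i+1}` in the numbering that starts from 1. All relations are invariant under
this shift of the indices.
-/

namespace ParenBraid

/-- The letters `σ_*` and `a_*`. -/
inductive Letter : Type
  | sigma (i : ℕ) : Letter
  | a (i : ℕ) : Letter

/-- The letter `σ` in the free group on the letters. -/
def freeSigma (i : ℕ) : FreeGroup Letter := FreeGroup.of (Letter.sigma i)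

/-- The letter `a` in the free group on the letters. -/
def freeA (i : ℕ) : FreeGroup Letter := FreeGroup.of (Letter.a i)

/-- The pairs `(u, v)` of words such that `u = v` is one of the defining relations of the group
of parenthesized braids. In the families with `i` and `k`, the index `k` is `j - 1`, so that
`i + 1 ≤ k` means `i + 2 ≤ j`. -/
inductive BulletRel : FreeGroup Letter → FreeGroup Letter → Prop
  | sigma_sigma (i j : ℕ) (h : i + 2 ≤ j) :
      BulletRel (freeSigma i * freeSigma j) (freeSigma j * freeSigma i)
  | sigma_a (i j : ℕ) (h : i + 2 ≤ j) :
      BulletRel (freeSigma i * freeA j) (freeA j * freeSigma i)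
  | a_a (i k : ℕ) (h : i + 1 ≤ k) :
      BulletRel (freeA i * freeA k) (freeA (k + 1) * freeA i)
  | a_sigma (i k : ℕ) (h : i + 1 ≤ k) :
      BulletRel (freeA i * freeSigma k) (freeSigma (k + 1) * freeA i)
  | braid (i : ℕ) :
      BulletRel (freeSigma i * freeSigma (i + 1) * freeSigma i)
        (freeSigma (i + 1) * freeSigma i * freeSigma (i + 1))
  | double_left (i : ℕ) :
      BulletRel (freeSigma (i + 1) * freeSigma i * freeA (i + 1)) (freeA i * freeSigma i)
  | double_right (i : ℕ) :
      BulletRel (freeSigma i * freeSigma (i + 1) * freeA i) (freeA (i + 1) * freeSigma i)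

/-- The defining relators `u v⁻¹` of the group of parenthesized braids. -/
def bulletRels : Set (FreeGroup Letter) :=
  {r | ∃ u v : FreeGroup Letter, BulletRel u v ∧ r = u * v⁻¹}

/-- The group `⟨a_*, σ_* ; R_•⟩` of parenthesized braids. -/
abbrev BBullet : Type := PresentedGroup bulletRels

/-- The element of `BBullet` represented by the letter `σ`. -/
def sigma (i : ℕ) : BBullet := PresentedGroup.of (Letter.sigma i)

/-- The element of `BBullet` represented by the letter `a`. -/
def a (i : ℕ) : BBullet := PresentedGroup.of (Letter.a i)

/-- The relators of Artin's presentation of the braid group on infinitely many strands. -/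
def artinRels : Set (FreeGroup ℕ) :=
  {r | ∃ i j : ℕ, i + 2 ≤ j ∧
      r = (FreeGroup.of i * FreeGroup.of j) * (FreeGroup.of j * FreeGroup.of i)⁻¹} ∪
  {r | ∃ i : ℕ,
      r = (FreeGroup.of i * FreeGroup.of (i + 1) * FreeGroup.of i) *
        (FreeGroup.of (i + 1) * FreeGroup.of i * FreeGroup.of (i + 1))⁻¹}

/-- Artin's braid group `B_∞`. -/
abbrev BraidGroup : Type := PresentedGroup artinRels

/-- The relators of the standard infinite presentation
`⟨x_0, x_1, … ; x_k⁻¹ x_n x_k = x_{n+1} for k < n⟩` of Thompson's group `F`. -/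
def thompsonRels : Set (FreeGroup ℕ) :=
  {r | ∃ k n : ℕ, k < n ∧
      r = ((FreeGroup.of k)⁻¹ * FreeGroup.of n * FreeGroup.of k) * (FreeGroup.of (n + 1))⁻¹}

/-- Thompson's group `F`, with generators `x_0, x_1, …`. -/
abbrev ThompsonF : Type := PresentedGroup thompsonRels

/-- The subgroup of `BBullet` generated by the `σ`'s. -/
def sigmaSubgroup : Subgroup BBullet := Subgroup.closure (Set.range sigma)

/-- The subgroup of `BBullet` generated by the `a`'s. -/
def aSubgroup : Subgroup BBullet := Subgroup.closure (Set.range a)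

end ParenBraid

/-! Reading `a j` as the splitting of a strand into two, the mixed relations all say that a
splitting passes across a braid by doubling a strand: `a j` times `b` equals (`b` with the strand
starting at `j` doubled) times `a (pos b j)`. Hence every product of braids and positive words in
the `a`'s can be written as a braid followed by a positive word. The proof builds the monoid
`BraidForest` of such pairs directly, embeds it in a group of left fractions, and maps `BBullet`
there. Only the existence of this map is needed, not that it is an isomorphism.

The construction rests on doubling being a well-defined cocycle on the braid group (`double_mul`),
injective because deleting one of the two copies undoes it (`remove_double`), and compatible with a
second doubling (`double_double`). The forest monoid is cancellative, since letters act injectively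
on normal forms, and it has common left multiples. Both properties pass to `BraidForest`, so Ore's
theorem gives `toFractions_injective`.

Braids therefore embed. An element of `F` is a left fraction of forests, and forests embed, so `F`
embeds too. If a braid `b` equals such a fraction, then `f * b = g` for forests `f` and `g`; moving
`b` across `f` only doubles strands, so injectivity of doubling forces `b = 1`. -/

namespace ParenBraid

/-! ### Artin's braid group -/

namespace Braid

/-- The generators of the braid group. -/
def s (i : ℕ) : BraidGroup := PresentedGroup.of i

theorem s_comm {i j : ℕ} (h : i + 2 ≤ j) : s i * s j = s j * s i :=
  PresentedGroup.mk_eq_mk_of_mul_inv_mem (Or.inl ⟨i, j, h, rfl⟩)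

theorem s_braid (i : ℕ) : s i * s (i + 1) * s i = s (i + 1) * s i * s (i + 1) :=
  PresentedGroup.mk_eq_mk_of_mul_inv_mem (Or.inr ⟨i, rfl⟩)

/-- The homomorphism from the braid group given by elements satisfying Artin's relations. -/
def lift {G : Type*} [Group G] (f : ℕ → G) (hc : ∀ i j, i + 2 ≤ j → f i * f j = f j * f i)
    (hb : ∀ i, f i * f (i + 1) * f i = f (i + 1) * f i * f (i + 1)) : BraidGroup →* G :=
  PresentedGroup.toGroup (f := f) (by
    rintro r (⟨i, j, h, rfl⟩ | ⟨i, rfl⟩)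
    · simp only [map_mul, map_inv, FreeGroup.lift_apply_of]
      rw [hc i j h, mul_inv_cancel]
    · simp only [map_mul, map_inv, FreeGroup.lift_apply_of]
      rw [hb i, mul_inv_cancel])

@[simp] theorem lift_s {G : Type*} [Group G] (f : ℕ → G) (hc hb) (i : ℕ) :
    lift f hc hb (s i) = f i := PresentedGroup.toGroup.of _

theorem induction {p : BraidGroup → Prop} (hs : ∀ i, p (s i)) (h1 : p 1)
    (hm : ∀ x y, p x → p y → p (x * y)) (hi : ∀ x, p x → p x⁻¹) (x : BraidGroup) : p x := by
  have hx : x ∈ Subgroup.closure (Set.range (PresentedGroup.of (rels := artinRels))) := by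
    rw [PresentedGroup.closure_range_of]; trivial
  induction hx using Subgroup.closure_induction with
  | mem x hx => obtain ⟨i, rfl⟩ := hx; exact hs i
  | one => exact h1
  | mul x y _ _ hx hy => exact hm x y hx hy
  | inv x _ hx => exact hi x hx

/-! ### Permutations and cocycles on braids -/

/-- The semidirect product recording a permutation of the strands together with an element of `G`
for every strand. -/
abbrev Decorated (G : Type) [Group G] : Type := (ℕ → G) ⋊[mulAutArrow] (Equiv.Perm ℕ)

/-- The inverse on the right is the reason why `pos` is defined through the inverse of `perm`. -/
theorem mulAutArrow_perm_apply {G : Type} [Group G] (p : Equiv.Perm ℕ) (f : ℕ → G) (j : ℕ) :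
    mulAutArrow p f j = f (p⁻¹ j) := rfl

/-- The involution exchanging `i` and `i + 1`. -/
def sw (i j : ℕ) : ℕ := if j = i then i + 1 else if j = i + 1 then i else j

theorem swap_eq_sw (i j : ℕ) : Equiv.swap i (i + 1) j = sw i j := by
  simp [Equiv.swap_apply_def, sw]

theorem sw_comm {i m : ℕ} (h : i + 2 ≤ m) (j : ℕ) : sw i (sw m j) = sw m (sw i j) := by
  simp only [sw]; split_ifs <;> omega

theorem sw_braid (i j : ℕ) : sw i (sw (i + 1) (sw i j)) = sw (i + 1) (sw i (sw (i + 1) j)) := by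
  simp only [sw]; split_ifs <;> omega

@[simp] theorem sw_left (i : ℕ) : sw i i = i + 1 := by simp [sw]

@[simp] theorem sw_right (i : ℕ) : sw i (i + 1) = i := by simp [sw]

theorem sw_of_lt {i j : ℕ} (h : j < i) : sw i j = j := by
  simp only [sw]; split_ifs <;> omega

theorem sw_of_gt {i j : ℕ} (h : i + 1 < j) : sw i j = j := by
  simp only [sw]; split_ifs <;> omega

/-- The transposition of `i` and `i + 1`, decorated by `f`. -/
def deco {G : Type} [Group G] (f : ℕ → ℕ → G) (i : ℕ) : Decorated G :=
  ⟨fun j => f j i, Equiv.swap i (i + 1)⟩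

/-- Elements of `G` attached to each strand of each generator of the braid group, subject to the
cocycle conditions, extend to the whole braid group. -/
def decoHom {G : Type} [Group G] (f : ℕ → ℕ → G)
    (hc : ∀ i m, i + 2 ≤ m → ∀ j, f j i * f (sw i j) m = f j m * f (sw m j) i)
    (hb : ∀ i j, f j i * f (sw i j) (i + 1) * f (sw (i + 1) (sw i j)) i =
      f j (i + 1) * f (sw (i + 1) j) i * f (sw i (sw (i + 1) j)) (i + 1)) :
    BraidGroup →* Decorated G :=
  lift (deco f)
    (by
      intro i m h
      ext j
      · simpa [deco, swap_eq_sw, mulAutArrow_perm_apply, -mulAutArrow_apply_apply] using hc i m h j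
      · simp [deco, swap_eq_sw, sw_comm h])
    (by
      intro i
      ext j
      · simpa [deco, swap_eq_sw, mulAutArrow_perm_apply, -mulAutArrow_apply_apply] using hb i j
      · simp [deco, swap_eq_sw, sw_braid])

/-- The permutation underlying a braid. -/
def perm : BraidGroup →* Equiv.Perm ℕ :=
  lift (fun i => Equiv.swap i (i + 1))
    (by intro i m h; ext j; simp [swap_eq_sw, sw_comm h])
    (by intro i; ext j; simp [swap_eq_sw, sw_braid])

/-- The position at the other end of a braid of the strand that starts at `j`. -/
def pos (b : BraidGroup) (j : ℕ) : ℕ := (perm b)⁻¹ j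

@[simp] theorem pos_one (j : ℕ) : pos 1 j = j := by simp [pos]

theorem pos_mul (b c : BraidGroup) (j : ℕ) : pos (b * c) j = pos c (pos b j) := by simp [pos]

@[simp] theorem pos_s (i j : ℕ) : pos (s i) j = sw i j := by simp [pos, perm, swap_eq_sw]

theorem pos_inv_pos (b : BraidGroup) (j : ℕ) : pos b (pos b⁻¹ j) = j := by
  rw [← pos_mul]; simp

theorem decoHom_right {G : Type} [Group G] (f : ℕ → ℕ → G) (hc hb) (b : BraidGroup) :
    (decoHom f hc hb b).right = perm b := by
  have : SemidirectProduct.rightHom.comp (decoHom f hc hb) = perm :=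
    PresentedGroup.ext fun i => by
      change (decoHom f hc hb (s i)).right = perm (s i)
      simp [decoHom, perm, deco]
  exact DFunLike.congr_fun this b

/-- The element attached to the strand that starts at `j`. -/
def label {G : Type} [Group G] (f : ℕ → ℕ → G)
    (hc : ∀ i m, i + 2 ≤ m → ∀ j, f j i * f (sw i j) m = f j m * f (sw m j) i)
    (hb : ∀ i j, f j i * f (sw i j) (i + 1) * f (sw (i + 1) (sw i j)) i =
      f j (i + 1) * f (sw (i + 1) j) i * f (sw i (sw (i + 1) j)) (i + 1))
    (j : ℕ) (b : BraidGroup) : G :=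
  (decoHom f hc hb b).left j

section label

variable {G : Type} [Group G] (f : ℕ → ℕ → G) (hc hb)

theorem label_s (i j : ℕ) : label f hc hb j (s i) = f j i := by
  simp [label, decoHom, deco]

theorem label_one (j : ℕ) : label f hc hb j 1 = 1 := by simp [label]

/-- The cocycle rule: the label of `c` is read at the position to which `b` carries the strand. -/
theorem label_mul (j : ℕ) (b c : BraidGroup) :
    label f hc hb j (b * c) = label f hc hb j b * label f hc hb (pos b j) c := by
  simp [label, decoHom_right, pos, mulAutArrow_perm_apply, -mulAutArrow_apply_apply]

end label

/-! ### Doubling a strand -/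

/-- The braid obtained from a generator by doubling the strand that starts at `j`. -/
def doubleGen (j i : ℕ) : BraidGroup :=
  if j < i then s (i + 1) else if j = i then s (i + 1) * s i
  else if j = i + 1 then s i * s (i + 1) else s i

theorem doubleGen_of_lt {i j : ℕ} (h : j < i) : doubleGen j i = s (i + 1) := by
  simp [doubleGen, h]

@[simp] theorem doubleGen_left (i : ℕ) : doubleGen i i = s (i + 1) * s i := by simp [doubleGen]

@[simp] theorem doubleGen_right (i : ℕ) : doubleGen (i + 1) i = s i * s (i + 1) := by
  simp [doubleGen]

theorem doubleGen_of_gt {i j : ℕ} (h : i + 1 < j) : doubleGen j i = s i := by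
  simp only [doubleGen]; split_ifs <;> first | omega | rfl

/-- The two crossings share no strand, so doubling in one at most shifts the index of the other;
every case reduces to commutations of distant generators. -/
theorem doubleGen_comm (i m : ℕ) (h : i + 2 ≤ m) (j : ℕ) :
    doubleGen j i * doubleGen (sw i j) m = doubleGen j m * doubleGen (sw m j) i := by
  rcases lt_trichotomy j i with h1 | rfl | h1
  · rw [sw_of_lt h1, sw_of_lt (by omega : j < m), doubleGen_of_lt h1,
      doubleGen_of_lt (by omega : j < m), s_comm (by omega)]
  · rw [sw_left, sw_of_lt (by omega : j < m), doubleGen_left,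
      doubleGen_of_lt (by omega : j + 1 < m), doubleGen_of_lt (by omega : j < m),
      mul_assoc, s_comm (by omega : j + 2 ≤ m + 1), ← mul_assoc,
      s_comm (by omega : j + 1 + 2 ≤ m + 1), mul_assoc]
  rcases Nat.lt_or_ge (i + 1) j with h2 | h2
  · rw [sw_of_gt h2, doubleGen_of_gt h2]
    rcases lt_trichotomy j m with h3 | rfl | h3
    · rw [sw_of_lt h3, doubleGen_of_lt h3, doubleGen_of_gt h2, s_comm (by omega)]
    · rw [sw_left, doubleGen_left, doubleGen_of_gt (by omega : i + 1 < j + 1),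
        ← mul_assoc, s_comm (by omega : i + 2 ≤ j + 1), mul_assoc, s_comm h, mul_assoc]
    rcases Nat.lt_or_ge (m + 1) j with h4 | h4
    · rw [sw_of_gt h4, doubleGen_of_gt h4, doubleGen_of_gt h2, s_comm (by omega)]
    · obtain rfl : j = m + 1 := by omega
      rw [sw_right, doubleGen_right, doubleGen_of_gt (by omega : i + 1 < m),
        ← mul_assoc, s_comm h, mul_assoc, s_comm (by omega : i + 2 ≤ m + 1), mul_assoc]
  · obtain rfl : j = i + 1 := by omega
    rw [sw_right, sw_of_lt (by omega : i + 1 < m), doubleGen_right,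
      doubleGen_of_lt (by omega : i < m), doubleGen_of_lt (by omega : i + 1 < m),
      mul_assoc, s_comm (by omega : i + 1 + 2 ≤ m + 1), ← mul_assoc,
      s_comm (by omega : i + 2 ≤ m + 1), mul_assoc]

theorem s_braid' (i : ℕ) (x : BraidGroup) :
    s i * (s (i + 1) * (s i * x)) = s (i + 1) * (s i * (s (i + 1) * x)) := by
  simpa only [mul_assoc] using congrArg (· * x) (s_braid i)

theorem s_comm' {i j : ℕ} (h : i + 2 ≤ j) (x : BraidGroup) :
    s i * (s j * x) = s j * (s i * x) := by
  simpa only [mul_assoc] using congrArg (· * x) (s_comm h)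

/-- When `j` is `i`, `i + 1` or `i + 2`, one of the three strands of the braid relation is doubled,
and the identity becomes one between words in `s i`, `s (i + 1)`, `s (i + 2)`. Otherwise it is the
braid relation, shifted or unchanged. -/
theorem doubleGen_braid (i j : ℕ) :
    doubleGen j i * doubleGen (sw i j) (i + 1) * doubleGen (sw (i + 1) (sw i j)) i =
      doubleGen j (i + 1) * doubleGen (sw (i + 1) j) i *
        doubleGen (sw i (sw (i + 1) j)) (i + 1) := by
  have b1 := s_braid i
  have b2 := s_braid (i + 1)
  simp only [mul_assoc] at b1 b2
  rcases lt_trichotomy j i with h1 | rfl | h1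
  · simp only [sw_of_lt h1, sw_of_lt (by omega : j < i + 1), doubleGen_of_lt h1,
      doubleGen_of_lt (by omega : j < i + 1), s_braid]
  · rw [sw_left, sw_left, sw_of_lt (by omega : j < j + 1), sw_left, doubleGen_left,
      doubleGen_left, doubleGen_of_gt (by omega), doubleGen_of_lt (by omega)]
    simp only [mul_assoc]
    rw [s_comm' (by omega : j + 2 ≤ j + 1 + 1), b1, s_braid', s_comm' (by omega : j + 2 ≤ j + 1 + 1)]
  rcases Nat.lt_or_ge (i + 2) j with h2 | h2
  · simp only [sw_of_gt (by omega : i + 1 < j), sw_of_gt (by omega : i + 1 + 1 < j),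
      doubleGen_of_gt (by omega : i + 1 < j), doubleGen_of_gt (by omega : i + 1 + 1 < j), s_braid]
  rcases Nat.lt_or_ge (i + 1) j with h3 | h3
  · obtain rfl : j = i + 1 + 1 := by omega
    rw [sw_of_gt (by omega : i + 1 < i + 1 + 1), sw_right, sw_right,
      doubleGen_right, doubleGen_right, doubleGen_of_gt (by omega), doubleGen_of_lt (by omega)]
    simp only [mul_assoc]
    rw [← s_comm' (by omega : i + 2 ≤ i + 1 + 1), ← s_comm' (by omega : i + 2 ≤ i + 1 + 1),
      s_braid', b2]
  · obtain rfl : j = i + 1 := by omega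
    rw [sw_right, sw_of_lt (by omega : i < i + 1), sw_left,
      sw_of_gt (by omega : i + 1 < i + 1 + 1),
      doubleGen_right, doubleGen_right, doubleGen_left, doubleGen_of_gt (by omega : i + 1 < i + 1 + 1),
      doubleGen_of_lt (by omega : i < i + 1), doubleGen_left]
    simp only [mul_assoc]
    rw [s_braid' (i + 1), s_comm' (by omega : i + 2 ≤ i + 1 + 1),
      ← s_comm (by omega : i + 2 ≤ i + 1 + 1), s_braid']

/-- Doubling the strand that starts at `j`. -/
def double (j : ℕ) (b : BraidGroup) : BraidGroup := label doubleGen doubleGen_comm doubleGen_braid j b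

@[simp] theorem double_one (j : ℕ) : double j 1 = 1 := label_one ..

@[simp] theorem double_s (i j : ℕ) : double j (s i) = doubleGen j i := label_s ..

theorem double_mul (j : ℕ) (b c : BraidGroup) :
    double j (b * c) = double j b * double (pos b j) c := label_mul ..

/-! ### Removing a strand -/

/-- The braid obtained from a generator by removing the strand that starts at `j`. -/
def removeGen (j i : ℕ) : BraidGroup :=
  if j < i then s (i - 1) else if j ≤ i + 1 then 1 else s i

theorem removeGen_of_lt {i j : ℕ} (h : j < i + 1) : removeGen j (i + 1) = s i := by
  simp [removeGen, h]

@[simp] theorem removeGen_left (i : ℕ) : removeGen i i = 1 := by simp [removeGen]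

@[simp] theorem removeGen_right (i : ℕ) : removeGen (i + 1) i = 1 := by simp [removeGen]

theorem removeGen_of_gt {i j : ℕ} (h : i + 1 < j) : removeGen j i = s i := by
  simp only [removeGen]; split_ifs <;> first | omega | rfl

theorem removeGen_comm (i m : ℕ) (h : i + 2 ≤ m) (j : ℕ) :
    removeGen j i * removeGen (sw i j) m = removeGen j m * removeGen (sw m j) i := by
  simp only [removeGen, sw]
  split_ifs <;> first | omega | simp only [one_mul, mul_one] | exact s_comm (by omega)

/-- If the removed strand is one of the three involved, a single crossing `s i` survives on each
side. -/
theorem removeGen_braid (i j : ℕ) :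
    removeGen j i * removeGen (sw i j) (i + 1) * removeGen (sw (i + 1) (sw i j)) i =
      removeGen j (i + 1) * removeGen (sw (i + 1) j) i *
        removeGen (sw i (sw (i + 1) j)) (i + 1) := by
  rcases lt_trichotomy j i with h1 | rfl | h1
  -- As `j < i`, the index is positive, so the truncated `i - 1` in `removeGen` is a true
  -- predecessor.
  · obtain ⟨i, rfl⟩ : ∃ k, i = k + 1 := ⟨i - 1, by omega⟩
    simp only [sw_of_lt h1, sw_of_lt (by omega : j < i + 1 + 1), removeGen_of_lt h1,
      removeGen_of_lt (by omega : j < i + 1 + 1), s_braid]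
  · simp [removeGen_of_lt, removeGen_of_gt, sw_of_lt]
  rcases Nat.lt_or_ge (i + 2) j with h2 | h2
  · simp only [sw_of_gt (by omega : i + 1 < j), sw_of_gt (by omega : i + 1 + 1 < j),
      removeGen_of_gt (by omega : i + 1 < j), removeGen_of_gt (by omega : i + 1 + 1 < j), s_braid]
  rcases Nat.lt_or_ge (i + 1) j with h3 | h3
  · obtain rfl : j = i + 1 + 1 := by omega
    rw [sw_of_gt (by omega : i + 1 < i + 1 + 1), sw_right, sw_right, removeGen_right,
      removeGen_right, removeGen_of_gt (by omega), removeGen_of_lt (by omega)]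
    simp
  · obtain rfl : j = i + 1 := by omega
    rw [sw_right, sw_of_lt (by omega : i < i + 1), sw_left, sw_of_gt (by omega : i + 1 < i + 1 + 1),
      removeGen_right, removeGen_right, removeGen_left, removeGen_of_gt (by omega : i + 1 < i + 1 + 1),
      removeGen_of_lt (by omega : i < i + 1), removeGen_left, one_mul, mul_one]

/-- Removing the strand that starts at `j`. -/
def remove (j : ℕ) (b : BraidGroup) : BraidGroup := label removeGen removeGen_comm removeGen_braid j b

@[simp] theorem remove_one (j : ℕ) : remove j 1 = 1 := label_one ..

@[simp] theorem remove_s (i j : ℕ) : remove j (s i) = removeGen j i := label_s ..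

theorem remove_mul (j : ℕ) (b c : BraidGroup) :
    remove j (b * c) = remove j b * remove (pos b j) c := label_mul ..

/-! ### Interaction of doublings with each other and with removal -/

/-- The renumbering of the strands after the strand `k` has been doubled; `k` itself is sent to the
left copy. -/
def sh (k x : ℕ) : ℕ := if x ≤ k then x else x + 1

@[simp] theorem sh_self (k : ℕ) : sh k k = k := by simp [sh]

theorem double_inv (k : ℕ) (b : BraidGroup) : double k b⁻¹ = (double (pos b⁻¹ k) b)⁻¹ := by
  rw [eq_inv_iff_mul_eq_one, ← double_mul, inv_mul_cancel, double_one]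

theorem pos_inv_eq_iff (b : BraidGroup) (i j : ℕ) : pos b⁻¹ i = j ↔ pos b j = i := by
  constructor
  · rintro rfl; exact pos_inv_pos b i
  · rintro rfl; simpa using pos_inv_pos b⁻¹ j

/-- Since `sh k` skips only `k + 1`, this follows every strand except the right copy. Both indices
stay universally quantified because a product moves them. -/
theorem pos_double (b : BraidGroup) : ∀ k x, pos (double k b) (sh k x) = sh (pos b k) (pos b x) := by
  induction b using induction with
  | hs i =>
    intro k x
    simp only [double_s, doubleGen, pos_s]
    split_ifs <;> simp only [pos_mul, pos_s] <;> simp only [sw, sh] <;> split_ifs <;> omega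
  | h1 => simp
  | hm b c hb hc => intro k x; rw [double_mul, pos_mul, hb, hc, pos_mul, pos_mul]
  | hi b hb =>
    intro k x
    rw [double_inv, pos_inv_eq_iff, hb, pos_inv_pos, pos_inv_pos]

/-- Removal deletes the left copy of the doubled strand; by `pos_double` left copies end at left
copies, so the cocycle rules of the two operations match. -/
theorem remove_double (b : BraidGroup) : ∀ k, remove k (double k b) = b := by
  induction b using induction with
  | hs i =>
    intro k
    simp only [double_s, doubleGen]
    rcases lt_trichotomy k i with h1 | rfl | h1
    · rw [if_pos h1, remove_s, removeGen_of_lt (by omega)]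
    · simp [remove_mul, removeGen_of_lt, sw_of_lt]
    rcases Nat.lt_or_ge (i + 1) k with h2 | h2
    · simp [show ¬ k < i by omega, show k ≠ i by omega, show k ≠ i + 1 by omega,
        removeGen_of_gt h2]
    · obtain rfl : k = i + 1 := by omega
      simp [remove_mul, removeGen_of_lt]
  | h1 => simp
  | hm b c hb hc =>
    intro k
    have := pos_double b k k
    rw [sh_self, sh_self] at this
    rw [double_mul, remove_mul, hb, this, hc]
  | hi b hb =>
    intro k
    have h := hb (pos b⁻¹ k)
    have h2 := pos_double b⁻¹ k k
    rw [sh_self, sh_self, double_inv] at h2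
    have h3 := remove_mul k (double (pos b⁻¹ k) b)⁻¹ (double (pos b⁻¹ k) b)
    rw [inv_mul_cancel, remove_one, h2, h] at h3
    rw [double_inv, eq_inv_iff_mul_eq_one, ← h3]

theorem double_injective (k : ℕ) : Function.Injective (double k) :=
  Function.LeftInverse.injective (g := remove k) fun b => remove_double b k

/-- Doubling two strands does not depend on the order, up to renumbering. On generators the case `i
< k` suffices by symmetry. -/
theorem double_double (b : BraidGroup) :
    ∀ i k, double (sh k i) (double k b) = double (sh i k) (double i b) := by
  induction b using induction with
  | hs m =>
    have key : ∀ i k, i < k → double i (double k (s m)) = double (k + 1) (double i (s m)) := by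
      intro i k h
      simp only [double_s]
      rcases Nat.lt_or_ge k m with h1 | h1
      · rw [doubleGen_of_lt h1, doubleGen_of_lt (by omega), double_s, double_s,
          doubleGen_of_lt (by omega), doubleGen_of_lt (by omega)]
      rcases Nat.lt_or_ge (m + 1) i with h2 | h2
      · rw [doubleGen_of_gt (by omega), doubleGen_of_gt (by omega), double_s, double_s,
          doubleGen_of_gt (by omega), doubleGen_of_gt (by omega)]
      rcases Nat.lt_or_ge (m + 1) k with h3 | h3
      · rw [doubleGen_of_gt (by omega : m + 1 < k), double_s]
        rcases lt_trichotomy i m with h4 | rfl | h4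
        · rw [doubleGen_of_lt h4, double_s, doubleGen_of_gt (by omega)]
        · rw [doubleGen_left, double_mul, pos_s, sw_of_gt (by omega), double_s, double_s,
            doubleGen_of_gt (by omega), doubleGen_of_gt (by omega)]
        · obtain rfl : i = m + 1 := by omega
          rw [doubleGen_right, double_mul, pos_s, sw_of_gt (by omega), double_s, double_s,
            doubleGen_of_gt (by omega), doubleGen_of_gt (by omega)]
      rcases Nat.lt_or_ge i m with h4 | h4
      · rw [doubleGen_of_lt h4, double_s]
        rcases Nat.lt_or_ge m k with h5 | h5
        · obtain rfl : k = m + 1 := by omega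
          rw [doubleGen_right, doubleGen_right, double_mul, pos_s, sw_of_lt (by omega), double_s,
            double_s, doubleGen_of_lt (by omega), doubleGen_of_lt (by omega)]
        · obtain rfl : k = m := by omega
          rw [doubleGen_left, doubleGen_left, double_mul, pos_s, sw_of_lt (by omega), double_s,
            double_s, doubleGen_of_lt (by omega), doubleGen_of_lt (by omega)]
      · obtain rfl : i = m := by omega
        obtain rfl : k = i + 1 := by omega
        rw [doubleGen_left, doubleGen_right, double_mul, double_mul, pos_s, pos_s, sw_left,
          sw_right, double_s, double_s, double_s, double_s, doubleGen_left, doubleGen_left,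
          doubleGen_right, doubleGen_right]
        simp only [mul_assoc]
        -- With both strands of the crossing doubled there are four crossings; the two orders of
        -- doubling differ by exchanging the two middle, disjoint ones.
        rw [s_comm' (by omega : i + 2 ≤ i + 1 + 1)]
    intro i k
    rcases lt_trichotomy i k with h | rfl | h
    · simpa only [sh, if_pos h.le, if_neg h.not_ge] using key i k h
    · rfl
    · simpa only [sh, if_pos h.le, if_neg h.not_ge] using (key k i h).symm
  | h1 => simp
  | hm b c hb hc =>
    intro i k
    rw [double_mul, double_mul, double_mul, double_mul, pos_double, pos_double, hb, hc]
  | hi b hb =>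
    intro i k
    have e : ∀ i k, double (sh k i) (double k b⁻¹) =
        (double (sh (pos b⁻¹ k) (pos b⁻¹ i)) (double (pos b⁻¹ k) b))⁻¹ := by
      intro i k
      rw [double_inv, double_inv]
      congr 2
      rw [pos_inv_eq_iff, pos_double, pos_inv_pos, pos_inv_pos]
    rw [e, e, hb]

end Braid

/-! ### The monoid of forests: normal forms, cancellation, common multiples -/

/-- The relations `a_i a_k = a_{k+1} a_i` for `i < k` of the monoid of positive elements of
Thompson's group. -/
inductive ForestRel : FreeMonoid ℕ → FreeMonoid ℕ → Prop
  | rel (i k : ℕ) (h : i < k) : ForestRel (.of i * .of k) (.of (k + 1) * .of i)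

/-- The monoid of positive elements of Thompson's group. -/
abbrev Forest : Type := PresentedMonoid ForestRel

namespace Forest

/-- The generators of the monoid. -/
def x (i : ℕ) : Forest := PresentedMonoid.of ForestRel i

theorem x_mul_x {i k : ℕ} (h : i < k) : x i * x k = x (k + 1) * x i :=
  PresentedMonoid.mk_eq_mk_of_rel (.rel i k h)

/-- The relation in a form symmetric in `i` and `k`, parallel to `double_double`; it also exhibits a
common left multiple of any two generators. -/
theorem x_sh (i k : ℕ) : x (Braid.sh k i) * x k = x (Braid.sh i k) * x i := by
  rcases lt_trichotomy i k with h | rfl | h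
  · simpa only [Braid.sh, if_pos h.le, if_neg h.not_ge] using x_mul_x h
  · rfl
  · simpa only [Braid.sh, if_pos h.le, if_neg h.not_ge] using (x_mul_x h).symm

/-- The homomorphism given by elements satisfying the relations. -/
def lift {M : Type*} [Monoid M] (f : ℕ → M)
    (h : ∀ i k, i < k → f i * f k = f (k + 1) * f i) : Forest →* M :=
  PresentedMonoid.lift f (by rintro _ _ ⟨i, k, hik⟩; simpa using h i k hik)

theorem induction_left {p : Forest → Prop} (h1 : p 1) (hm : ∀ i f, p f → p (x i * f))
    (f : Forest) : p f := by
  have hf : f ∈ Submonoid.closure (Set.range (PresentedMonoid.of ForestRel)) := by simp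
  induction hf using Submonoid.closure_induction_left with
  | one => exact h1
  | mul_left _ hx _ _ hy => obtain ⟨i, rfl⟩ := hx; exact hm i _ hy

theorem induction_right {p : Forest → Prop} (h1 : p 1) (hm : ∀ f i, p f → p (f * x i))
    (f : Forest) : p f := by
  have hf : f ∈ Submonoid.closure (Set.range (PresentedMonoid.of ForestRel)) := by simp
  induction hf using Submonoid.closure_induction_right with
  | one => exact h1
  | mul_right _ _ _ hx hy => obtain ⟨i, rfl⟩ := hx; exact hm _ i hy

/-- The element represented by a list of indices. -/
def ofList (l : List ℕ) : Forest := (l.map x).prod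

/-- Insertion of a letter into a nonincreasing normal form, from the left. -/
def insertLeft (i : ℕ) : List ℕ → List ℕ
  | [] => [i]
  | k :: l => if i < k then (k + 1) :: insertLeft i l else i :: k :: l

/-- The head of the result exceeds `i` exactly when the recursive branch was taken, so each
insertion can be undone. -/
theorem insertLeft_injective (i : ℕ) : Function.Injective (insertLeft i) := by
  intro l
  induction l with
  | nil =>
    rintro (_ | ⟨k, l'⟩) h
    · rfl
    · simp only [insertLeft] at h; split_ifs at h <;> simp at h; omega
  | cons m l ih =>
    rintro (_ | ⟨k, l'⟩) h
    · simp only [insertLeft] at h; split_ifs at h <;> simp at h; omega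
    · simp only [insertLeft] at h
      split_ifs at h
      · simp only [List.cons.injEq, add_left_inj] at h
        rw [h.1, ih h.2]
      · simp at h; omega
      · simp at h; omega
      · simpa using h

/-- No monotonicity of `l` is needed, so the monoid acts on all lists. -/
theorem insertLeft_insertLeft {i k : ℕ} (h : i < k) (l : List ℕ) :
    insertLeft i (insertLeft k l) = insertLeft (k + 1) (insertLeft i l) := by
  induction l with
  | nil => simp [insertLeft, h, show ¬ k + 1 < i by omega]
  | cons m l ih =>
    by_cases h1 : k < m
    · simp [insertLeft, h1, show i < m by omega, show i < m + 1 by omega, ih]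
    · by_cases h2 : i < m
      · simp [insertLeft, h1, h2, h]
      · simp [insertLeft, h1, h2, h, show ¬ k + 1 < i by omega]

theorem ofList_insertLeft (i : ℕ) (l : List ℕ) : ofList (insertLeft i l) = x i * ofList l := by
  induction l with
  | nil => simp [insertLeft, ofList]
  | cons m l ih =>
    simp only [insertLeft]
    split_ifs with h
    · simp only [ofList, List.map_cons, List.prod_cons] at ih ⊢
      rw [ih, ← mul_assoc, ← x_mul_x h, mul_assoc]
    · simp [ofList]

/-- The action of the monoid on normal forms, from the left. -/
def actLeft : Forest →* Function.End (List ℕ) :=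
  lift (M := Function.End (List ℕ)) insertLeft fun _ _ h => funext fun l => insertLeft_insertLeft h l

theorem actLeft_injective (f : Forest) : Function.Injective (actLeft f) := by
  induction f using induction_left with
  | h1 => rw [map_one]; exact Function.injective_id
  | hm i f ih => rw [map_mul]; exact (insertLeft_injective i).comp ih

theorem ofList_actLeft (f : Forest) (l : List ℕ) : ofList (actLeft f l) = f * ofList l := by
  induction f using induction_left with
  | h1 => simp; rfl
  | hm i f ih =>
    rw [map_mul, mul_assoc, ← ih]
    exact ofList_insertLeft i _

/-- Insertion of a letter into a nonincreasing normal form written backwards, from the right. -/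
def insertRight (i : ℕ) : List ℕ → List ℕ
  | [] => [i]
  | k :: l => if k < i then k :: insertRight (i + 1) l else i :: k :: l

theorem insertRight_injective (l : List ℕ) :
    ∀ (i : ℕ) (l' : List ℕ), insertRight i l = insertRight i l' → l = l' := by
  induction l with
  | nil =>
    rintro i (_ | ⟨k, l'⟩) h
    · rfl
    · simp only [insertRight] at h; split_ifs at h <;> simp at h; omega
  | cons m l ih =>
    rintro i (_ | ⟨k, l'⟩) h
    · simp only [insertRight] at h; split_ifs at h <;> simp at h; omega
    · simp only [insertRight] at h
      split_ifs at h
      · simp only [List.cons.injEq] at h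
        rw [h.1, ih _ _ h.2]
      · simp at h; omega
      · simp at h; omega
      · simpa using h

theorem insertRight_insertRight (l : List ℕ) : ∀ {i k : ℕ}, i < k →
    insertRight k (insertRight i l) = insertRight i (insertRight (k + 1) l) := by
  induction l with
  | nil => intro i k h; simp [insertRight, h, show ¬ k + 1 < i by omega]
  | cons m l ih =>
    intro i k h
    by_cases h1 : m < i
    · simp [insertRight, h1, show m < k by omega, show m < k + 1 by omega,
        ih (show i + 1 < k + 1 by omega)]
    · by_cases h2 : m < k + 1
      · simp [insertRight, h1, h2, h]
      · simp [insertRight, h1, h2, h, show ¬ k + 1 < i by omega]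

theorem ofList_reverse_insertRight (l : List ℕ) :
    ∀ i : ℕ, ofList (insertRight i l).reverse = ofList l.reverse * x i := by
  induction l with
  | nil => simp [insertRight, ofList]
  | cons m l ih =>
    intro i
    simp only [insertRight]
    split_ifs with h
    · simp only [ofList, List.reverse_cons, List.map_append, List.prod_append, List.map_cons,
        List.map_nil, List.prod_singleton] at ih ⊢
      rw [ih, mul_assoc, mul_assoc, ← x_mul_x h]
    · simp [ofList, mul_assoc]

/-- The action of the monoid on normal forms, from the right. -/
def actRight : Forest →* (Function.End (List ℕ))ᵐᵒᵖ :=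
  lift (M := (Function.End (List ℕ))ᵐᵒᵖ) (fun i => .op (insertRight i)) fun _ _ h =>
    MulOpposite.unop_injective (funext fun l => insertRight_insertRight l h)

theorem actRight_mul_x (f : Forest) (i : ℕ) (l : List ℕ) :
    (actRight (f * x i)).unop l = insertRight i ((actRight f).unop l) := by
  rw [map_mul]; rfl

theorem ofList_actRight (f : Forest) : ofList ((actRight f).unop []).reverse = f := by
  induction f using induction_right with
  | h1 => rfl
  | hm f i ih => rw [actRight_mul_x, ofList_reverse_insertRight, ih]

/-- The injective action of `f` identifies the normal forms `actLeft g []` and `actLeft g' []`, and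
`ofList` evaluates these to `g` and `g'`. -/
instance : IsLeftCancelMul Forest where
  mul_left_cancel f g g' h := by
    have h' : actLeft (f * g) [] = actLeft (f * g') [] := congrArg (fun u => actLeft u []) h
    rw [map_mul, map_mul] at h'
    simpa [ofList_actLeft, show ofList [] = 1 from rfl] using
      congrArg ofList (actLeft_injective f h')

instance : IsRightCancelMul Forest where
  mul_right_cancel f g g' h := by
    induction f using induction_right with
    | h1 => simpa using h
    | hm f i ih =>
      refine ih ?_
      have h' : (g * f) * x i = (g' * f) * x i := by simpa [mul_assoc] using h
      have h2 := congrArg (fun u => (actRight u).unop []) h'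
      simp only [actRight_mul_x] at h2
      have h3 := congrArg (fun l : List ℕ => ofList l.reverse) (insertRight_injective _ _ _ h2)
      simpa only [ofList_actRight] using h3

/-- Keeping `v` to at most one letter lets the induction run: the letter left over from the last
factor of `f` is passed on to the remaining ones. -/
theorem exists_mul_x_eq (f : Forest) : ∀ i, ∃ u v, u * x i = v * f ∧ (v = 1 ∨ ∃ j, v = x j) := by
  have gen : ∀ i k, ∃ u v, u * x i = v * x k ∧ (v = 1 ∨ ∃ j, v = x j) := fun i k =>
    ⟨x (Braid.sh i k), x (Braid.sh k i), (x_sh i k).symm, .inr ⟨_, rfl⟩⟩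
  induction f using induction_right with
  | h1 => exact fun i => ⟨1, x i, by simp, .inr ⟨i, rfl⟩⟩
  | hm f k ih =>
    intro i
    obtain ⟨u, v, h, rfl | ⟨j, rfl⟩⟩ := gen i k
    · exact ⟨f * u, 1, by rw [mul_assoc, h, one_mul, one_mul], .inl rfl⟩
    · obtain ⟨u', v', h', hv'⟩ := ih j
      exact ⟨u' * u, v', by rw [mul_assoc, h, ← mul_assoc, h', mul_assoc], hv'⟩

theorem exists_mul_eq_mul (g : Forest) : ∀ f : Forest, ∃ u v, u * f = v * g := by
  induction g using induction_right with
  | h1 => exact fun f => ⟨1, f, by simp⟩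
  | hm g i ih =>
    intro f
    obtain ⟨u, v, h, -⟩ := exists_mul_x_eq f i
    obtain ⟨u', v', h'⟩ := ih u
    exact ⟨u' * v, v', by rw [mul_assoc, ← h, ← mul_assoc, h', mul_assoc]⟩

end Forest

/-! ### The monoid of braids followed by forests -/

/-- The Zappa–Szép product of the braid group with the monoid of positive elements of Thompson's
group: elements are braids followed by positive forests. -/
@[ext]
structure BraidForest : Type where
  /-- The braid. -/
  braid : BraidGroup
  /-- The forest. -/
  forest : Forest

namespace BraidForest

open Braid Forest

/-- Left multiplication by a letter `a`. -/
def actGen (j : ℕ) (p : BraidForest) : BraidForest :=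
  ⟨double j p.braid, x (pos p.braid j) * p.forest⟩

/-- The braid components agree by `double_double`; the forest components agree by `x_sh`, once
`pos_double` has located the strands. -/
theorem actGen_actGen {i k : ℕ} (h : i < k) (p : BraidForest) :
    actGen i (actGen k p) = actGen (k + 1) (actGen i p) := by
  have h1 : sh k i = i := by simp [sh, h.le]
  have h2 : sh i k = k + 1 := by simp [sh, h]
  have e1 := pos_double p.braid k i
  have e2 := pos_double p.braid i k
  have e3 := double_double p.braid i k
  rw [h1] at e1
  rw [h2] at e2
  rw [h1, h2] at e3
  ext
  · exact e3
  · simp only [actGen, e1, e2, ← mul_assoc, x_sh]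

/-- Left multiplication by a forest. -/
def act : Forest →* Function.End BraidForest :=
  Forest.lift (M := Function.End BraidForest) actGen fun _ _ h => funext (actGen_actGen h)

theorem act_one (p : BraidForest) : act 1 p = p := by rw [map_one]; rfl

theorem act_mul (f g : Forest) (p : BraidForest) : act (f * g) p = act f (act g p) := by
  rw [map_mul]; rfl

theorem act_x_mul (i : ℕ) (f : Forest) (p : BraidForest) :
    act (x i * f) p = actGen i (act f p) := act_mul ..

instance : One BraidForest := ⟨⟨1, 1⟩⟩

instance : Mul BraidForest :=
  ⟨fun p q => ⟨p.braid * (act p.forest q).braid, (act p.forest q).forest⟩⟩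

theorem one_def : (1 : BraidForest) = ⟨1, 1⟩ := rfl

theorem mul_def (p q : BraidForest) :
    p * q = ⟨p.braid * (act p.forest q).braid, (act p.forest q).forest⟩ := rfl

/-- The cocycle rule for `double` in disguise; its extension to all forests is what associativity
amounts to. -/
theorem actGen_mul (i : ℕ) (p q : BraidForest) : actGen i (p * q) = actGen i p * q := by
  simp [mul_def, actGen, act_x_mul, double_mul, pos_mul]

theorem act_mul_eq (f : Forest) (p q : BraidForest) : act f (p * q) = act f p * q := by
  induction f using induction_left with
  | h1 => simp only [act_one]
  | hm i f ih => rw [act_x_mul, act_x_mul, ih, actGen_mul]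

theorem act_forest (f g : Forest) : act f ⟨1, g⟩ = ⟨1, f * g⟩ := by
  induction f using induction_left with
  | h1 => rw [act_one, one_mul]
  | hm i f ih => rw [act_x_mul, ih]; simp [actGen, mul_assoc]

instance : Monoid BraidForest where
  mul_assoc p q r := by
    have h := act_mul_eq p.forest q r
    have e : p * q * r = ⟨p.braid * (act p.forest q * r).braid, (act p.forest q * r).forest⟩ := by
      simp only [mul_def, mul_assoc]
    rw [e, ← h]
    rfl
  one_mul p := by simp [mul_def, one_def, act_one]
  mul_one p := by simp [mul_def, one_def, act_forest]

/-- Injectivity of doubling recovers the braid, hence the letter placed before the forest, which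
then cancels. -/
theorem actGen_injective (j : ℕ) : Function.Injective (actGen j) := by
  rintro ⟨b, f⟩ ⟨c, g⟩ h
  simp only [actGen, mk.injEq] at h
  obtain rfl := double_injective j h.1
  rw [mul_left_cancel h.2]

theorem act_injective (f : Forest) : Function.Injective (act f) := by
  induction f using induction_left with
  | h1 => rw [map_one]; exact Function.injective_id
  | hm i f ih => rw [map_mul]; exact (actGen_injective i).comp ih

theorem braid_eq_one_of_act (f : Forest) (p : BraidForest) (h : (act f p).braid = 1) :
    p.braid = 1 := by
  induction f using induction_left with
  | h1 => rwa [act_one] at h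
  | hm i f ih =>
    rw [act_x_mul] at h
    exact ih (double_injective i (h.trans (double_one i).symm))

/-- The inclusion of the braid group. -/
def ofBraid : BraidGroup →* BraidForest where
  toFun b := ⟨b, 1⟩
  map_one' := rfl
  map_mul' b c := by simp [mul_def, act_one]

/-- The inclusion of the monoid of forests. -/
def ofForest : Forest →* BraidForest where
  toFun f := ⟨1, f⟩
  map_one' := rfl
  map_mul' f g := by simp [mul_def, act_forest]

theorem ofBraid_mul_ofForest (b : BraidGroup) (f : Forest) : ofBraid b * ofForest f = ⟨b, f⟩ := by
  simp [ofBraid, ofForest, mul_def, act_one]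

/-- The exchange rule. For `b` a generator it specializes to every mixed relation of `BBullet`. -/
theorem ofForest_x_mul_ofBraid (j : ℕ) (b : BraidGroup) :
    ofForest (x j) * ofBraid b = ofBraid (double j b) * ofForest (x (pos b j)) := by
  rw [ofBraid_mul_ofForest]
  have := act_x_mul j 1 ⟨b, 1⟩
  rw [mul_one, act_one] at this
  simp [ofBraid, ofForest, mul_def, this, actGen]

theorem ofForest_mul_ofBraid_eq {f g : Forest} {b : BraidGroup}
    (h : ofForest f * ofBraid b = ofForest g) : b = 1 :=
  braid_eq_one_of_act f ⟨b, 1⟩ (by simpa [mul_def, ofForest, ofBraid] using congrArg braid h)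

theorem ofBraid_injective : Function.Injective ofBraid := fun _ _ h => congrArg braid h

theorem ofForest_injective : Function.Injective ofForest := fun _ _ h => congrArg forest h

instance : IsLeftCancelMul BraidForest where
  mul_left_cancel p q r h := by
    simp only [mul_def, mk.injEq, mul_right_inj] at h
    exact act_injective p.forest (BraidForest.ext h.1 h.2)

instance : IsRightCancelMul BraidForest where
  mul_right_cancel q p r h := by
    obtain ⟨c, g⟩ := q
    rw [← ofBraid_mul_ofForest] at h
    have key : ∀ u v : BraidForest, u * ofForest g = v * ofForest g → u = v := by
      intro u v huv
      simp only [mul_def, ofForest, MonoidHom.coe_mk, OneHom.coe_mk, act_forest, mk.injEq,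
        mul_one, mul_left_inj] at huv
      exact BraidForest.ext huv.1 huv.2
    have h1 : p * ofBraid c = r * ofBraid c := key _ _ (by simpa only [mul_assoc] using h)
    have h2 := congrArg (· * ofBraid c⁻¹) h1
    simpa [mul_assoc, ← map_mul] using h2

/-- Braids are invertible, so they are undone first, which leaves common left multiples of forests.
-/
theorem exists_mul_eq_mul (p q : BraidForest) : ∃ u v : BraidForest, u * p = v * q := by
  obtain ⟨b, f⟩ := p
  obtain ⟨c, g⟩ := q
  obtain ⟨u, v, h⟩ := Forest.exists_mul_eq_mul g f
  refine ⟨ofForest u * ofBraid b⁻¹, ofForest v * ofBraid c⁻¹, ?_⟩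
  have e : ∀ (w : Forest) (d : BraidGroup) (k : Forest),
      ofForest w * ofBraid d⁻¹ * (ofBraid d * ofForest k) = ofForest (w * k) := by
    intro w d k
    rw [mul_assoc, ← mul_assoc (ofBraid _), ← map_mul, inv_mul_cancel, map_one, one_mul, map_mul]
  rw [← ofBraid_mul_ofForest, ← ofBraid_mul_ofForest, e, e, h]

/-! ### The group of left fractions -/

noncomputable instance : OreLocalization.OreSet (⊤ : Submonoid BraidForest) where
  ore_right_cancel _ _ _ h := ⟨1, by rw [mul_right_cancel h]⟩
  oreNum p q := (exists_mul_eq_mul p q).choose_spec.choose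
  oreDenom p q := ⟨(exists_mul_eq_mul p q).choose, trivial⟩
  ore_eq p q := (exists_mul_eq_mul p q).choose_spec.choose_spec

/-- The group of left fractions. -/
abbrev Fractions : Type := (OreLocalization (⊤ : Submonoid BraidForest) BraidForest)ˣ

/-- The inclusion into the group of fractions. -/
noncomputable def toFractions : BraidForest →* Fractions where
  toFun p := OreLocalization.numeratorUnit ⟨p, trivial⟩
  map_one' := Units.ext (map_one OreLocalization.numeratorHom)
  map_mul' p q := Units.ext (map_mul OreLocalization.numeratorHom p q)

theorem toFractions_injective : Function.Injective toFractions := by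
  intro p q h
  have h' : p /ₒ (1 : (⊤ : Submonoid BraidForest)) = q /ₒ 1 := congrArg Units.val h
  rw [OreLocalization.oreDiv_eq_iff] at h'
  obtain ⟨u, v, h1, h2⟩ := h'
  -- Both denominators are 1, so the two multipliers coincide and left cancellation applies.
  simp only [OneMemClass.coe_one, mul_one] at h2
  rw [← h2] at h1
  exact (mul_left_cancel h1).symm

end BraidForest

/-! ### Comparison of the presented groups with the group of fractions -/

open Braid Forest BraidForest

theorem sigma_comm {i j : ℕ} (h : i + 2 ≤ j) : sigma i * sigma j = sigma j * sigma i :=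
  PresentedGroup.mk_eq_mk_of_mul_inv_mem ⟨_, _, .sigma_sigma i j h, rfl⟩

theorem sigma_braid (i : ℕ) :
    sigma i * sigma (i + 1) * sigma i = sigma (i + 1) * sigma i * sigma (i + 1) :=
  PresentedGroup.mk_eq_mk_of_mul_inv_mem ⟨_, _, .braid i, rfl⟩

theorem a_mul_a {i k : ℕ} (h : i < k) : a i * a k = a (k + 1) * a i :=
  PresentedGroup.mk_eq_mk_of_mul_inv_mem ⟨_, _, .a_a i k h, rfl⟩

/-- The homomorphism from Artin's braid group to the group of parenthesized braids. -/
def braidHom : BraidGroup →* BBullet := Braid.lift sigma (fun _ _ => sigma_comm) sigma_braid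

theorem braidHom_s (i : ℕ) : braidHom (s i) = sigma i := Braid.lift_s ..

theorem thompson_rel {k n : ℕ} (h : k < n) :
    (PresentedGroup.of k : ThompsonF)⁻¹ * PresentedGroup.of n * PresentedGroup.of k =
      PresentedGroup.of (n + 1) :=
  PresentedGroup.mk_eq_mk_of_mul_inv_mem ⟨k, n, h, rfl⟩

/-- The homomorphism from Thompson's group to the group of parenthesized braids. -/
def thompsonHom : ThompsonF →* BBullet :=
  PresentedGroup.toGroup (f := fun i => (a i)⁻¹) (by
    rintro _ ⟨k, n, h, rfl⟩
    simp only [map_mul, map_inv, FreeGroup.lift_apply_of, inv_inv]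
    rw [← mul_inv_eq_of_eq_mul (a_mul_a h)]
    group)

theorem thompsonHom_of (i : ℕ) : thompsonHom (PresentedGroup.of i) = (a i)⁻¹ :=
  PresentedGroup.toGroup.of _

/-- The homomorphism sending each generator of the monoid of forests to the inverse of a generator
of Thompson's group. -/
def forestHom : Forest →* ThompsonF :=
  Forest.lift (fun i => (PresentedGroup.of i)⁻¹) fun i k h => by
    rw [← thompson_rel h]; group

/-- Fractions are closed under products because `g * f'⁻¹` can be rewritten as `u⁻¹ * v`, where `u *
g = v * f'` is a common left multiple. -/
theorem exists_eq_inv_mul (t : ThompsonF) : ∃ f g, t = (forestHom f)⁻¹ * forestHom g := by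
  have ht : t ∈ Subgroup.closure (Set.range (PresentedGroup.of (rels := thompsonRels))) := by
    rw [PresentedGroup.closure_range_of]; trivial
  have hx : ∀ i, forestHom (x i) = (PresentedGroup.of i)⁻¹ := fun _ => rfl
  induction ht using Subgroup.closure_induction with
  | mem _ h => obtain ⟨i, rfl⟩ := h; exact ⟨x i, 1, by simp [hx]⟩
  | one => exact ⟨1, 1, by simp⟩
  | inv _ _ ih => obtain ⟨f, g, rfl⟩ := ih; exact ⟨g, f, by simp⟩
  | mul _ _ _ _ ih1 ih2 =>
    obtain ⟨f, g, rfl⟩ := ih1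
    obtain ⟨f', g', rfl⟩ := ih2
    obtain ⟨u, v, h⟩ := Forest.exists_mul_eq_mul f' g
    refine ⟨u * f, v * g', ?_⟩
    have h' := congrArg forestHom h
    rw [map_mul, map_mul, ← eq_inv_mul_iff_mul_eq] at h'
    rw [h', map_mul, map_mul]
    group

/-- The homomorphism from the group of parenthesized braids to the group of fractions. -/
noncomputable def fractionsHom : BBullet →* Fractions :=
  PresentedGroup.toGroup
    (f := fun l => match l with
      | .sigma i => toFractions (ofBraid (s i))
      | .a i => toFractions (ofForest (x i))) (by
    rintro _ ⟨u, v, h, rfl⟩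
    rw [map_mul, map_inv, mul_inv_eq_one]
    cases h <;> simp only [freeSigma, freeA, map_mul, FreeGroup.lift_apply_of] <;>
      simp only [← map_mul] <;> congr 1
    case sigma_sigma i j h => rw [s_comm h]
    case sigma_a i j h =>
      rw [ofForest_x_mul_ofBraid, double_s, pos_s, doubleGen_of_gt h, sw_of_gt h]
    case a_a i k h => rw [x_mul_x h]
    case a_sigma i k h =>
      rw [ofForest_x_mul_ofBraid, double_s, pos_s, doubleGen_of_lt h, sw_of_lt h]
    case braid i => rw [s_braid]
    case double_left i => rw [ofForest_x_mul_ofBraid, double_s, pos_s, doubleGen_left, sw_left]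
    case double_right i => rw [ofForest_x_mul_ofBraid, double_s, pos_s, doubleGen_right, sw_right])

theorem fractionsHom_braidHom (b : BraidGroup) :
    fractionsHom (braidHom b) = toFractions (ofBraid b) := by
  have : fractionsHom.comp braidHom = toFractions.comp ofBraid :=
    PresentedGroup.ext fun i => by
      change fractionsHom (braidHom (s i)) = _
      rw [braidHom_s]
      exact PresentedGroup.toGroup.of _
  exact DFunLike.congr_fun this b

theorem fractionsHom_thompsonHom (f : Forest) :
    fractionsHom (thompsonHom (forestHom f)) = toFractions (ofForest f) := by
  induction f using induction_left with
  | h1 => simp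
  | hm i f ih =>
    have hx : forestHom (x i) = (PresentedGroup.of i)⁻¹ := rfl
    have ha : fractionsHom (a i) = toFractions (ofForest (x i)) := PresentedGroup.toGroup.of _
    simp [ih, hx, thompsonHom_of, ha]

theorem braidHom_injective : Function.Injective braidHom := fun b c h =>
  ofBraid_injective (toFractions_injective (by
    rw [← fractionsHom_braidHom, h, fractionsHom_braidHom]))

/-- Writing `t` as a fraction reduces the claim to injectivity on forests, which is visible in the
group of fractions. -/
theorem thompsonHom_injective : Function.Injective thompsonHom := by
  rw [injective_iff_map_eq_one]
  intro t ht
  obtain ⟨f, g, rfl⟩ := exists_eq_inv_mul t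
  rw [map_mul, map_inv, inv_mul_eq_one] at ht
  have h := congrArg fractionsHom ht
  rw [fractionsHom_thompsonHom, fractionsHom_thompsonHom] at h
  rw [ofForest_injective (toFractions_injective h), inv_mul_cancel]

theorem range_braidHom : braidHom.range = sigmaSubgroup := by
  rw [MonoidHom.range_eq_map, ← PresentedGroup.closure_range_of, MonoidHom.map_closure,
    ← Set.range_comp]
  exact congrArg (fun f => Subgroup.closure (Set.range f)) (funext braidHom_s)

theorem range_thompsonHom : thompsonHom.range = aSubgroup := by
  rw [MonoidHom.range_eq_map, ← PresentedGroup.closure_range_of, MonoidHom.map_closure,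
    ← Set.range_comp, aSubgroup, ← Subgroup.closure_inv (Set.range a), Set.inv_range]
  exact congrArg (fun f => Subgroup.closure (Set.range f)) (funext thompsonHom_of)

theorem sup_eq_top : sigmaSubgroup ⊔ aSubgroup = ⊤ := by
  rw [eq_top_iff, ← PresentedGroup.closure_range_of, Subgroup.closure_le]
  rintro _ ⟨i | i, rfl⟩
  · exact Subgroup.mem_sup_left (Subgroup.subset_closure ⟨i, rfl⟩)
  · exact Subgroup.mem_sup_right (Subgroup.subset_closure ⟨i, rfl⟩)

theorem inf_eq_bot : sigmaSubgroup ⊓ aSubgroup = ⊥ := by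
  rw [eq_bot_iff, ← range_braidHom, ← range_thompsonHom]
  rintro _ ⟨⟨b, rfl⟩, ⟨t, ht⟩⟩
  obtain ⟨f, g, rfl⟩ := exists_eq_inv_mul t
  rw [map_mul, map_inv, inv_mul_eq_iff_eq_mul] at ht
  have h := congrArg fractionsHom ht
  -- The equation becomes `g = f * b` between elements of `BraidForest`, where the braid component
  -- can be compared with 1.
  rw [map_mul, fractionsHom_thompsonHom, fractionsHom_thompsonHom, fractionsHom_braidHom,
    ← map_mul] at h
  rw [ofForest_mul_ofBraid_eq (toFractions_injective h).symm, map_one]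
  exact Subgroup.one_mem _

end ParenBraid

theorem proposition2p23 :
    (∃ φ : ParenBraid.BraidGroup ≃* ParenBraid.sigmaSubgroup,
      ∀ i : ℕ, (φ (PresentedGroup.of i) : ParenBraid.BBullet) = ParenBraid.sigma i) ∧
    (∃ ψ : ParenBraid.ThompsonF ≃* ParenBraid.aSubgroup,
      ∀ i : ℕ, (ψ (PresentedGroup.of i) : ParenBraid.BBullet) = (ParenBraid.a i)⁻¹) ∧
    ParenBraid.sigmaSubgroup ⊔ ParenBraid.aSubgroup = ⊤ ∧
    ParenBraid.sigmaSubgroup ⊓ ParenBraid.aSubgroup = ⊥ :=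
  ⟨⟨(MonoidHom.ofInjective ParenBraid.braidHom_injective).trans
      (MulEquiv.subgroupCongr ParenBraid.range_braidHom), ParenBraid.braidHom_s⟩,
    ⟨(MonoidHom.ofInjective ParenBraid.thompsonHom_injective).trans
      (MulEquiv.subgroupCongr ParenBraid.range_thompsonHom), ParenBraid.thompsonHom_of⟩,
    ParenBraid.sup_eq_top, ParenBraid.inf_eq_bot⟩
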